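/- Let $n, d \in \mathbb{N}$. Let $\Sigma_{n,d}$ be the set of finite sums of squares of polynomials of degree at most $d$ in $\mathbb{R}[x_1,\dots,x_n]$. A polynomial $f \in \mathbb{R}[x_1,\dots,x_n]$ has a *degree $d$ SoS certificate of nonnegativity modulo the Boolean axioms* if, as an identity of polynomials, $$f = s_0 + \sum_{i=1}^n s_i\,(x_i^2 - x_i) + \sum_{i=1}^n s_i'\,\bigl(-(x_i^2 - x_i)\bigr)$$ with all $s_i, s_i' \in \Sigma_{n,d}$ and with $s_0$ a sum of squares of polynomials of degree at most $d+1$ (so that $\deg s_0 \le 2d+2$). For $k \in \mathbb{N}$ let $$q_k(\mathbf{x}) = (|\mathbf{x}| - k)(|\mathbf{x}| - k + 1), \qquad |\mathbf{x}| = x_1 + \dots + x_n .$$ **Theorem.** There is an absolute constant $K > 0$ such that for all $n \in \mathbb{N}$ and all $k \in \{2, \dots, \lceil n/2 \rceil\}$ the polynomial $q_k$ has an SoS certificate of nonnegativity modulo the Boolean axioms of some degree $d \le K \sqrt{nk}\,\log n$. Consequently the $\Omega(n)$ lower bound predicted by the conjecture of Lee, Prakash, de Wolf and Yuen fails: for every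 fixed $k \ge 2$ there is no constant $c > 0$ such that, for all sufficiently large $n$, every SoS certificate of $q_k$ modulo the Boolean axioms has degree at least $c\,n$. -/

import Mathlib

namespace BooleanSoS

open MvPolynomial

/-- `Σ_{n,d}`: the real polynomials in `n` variables that are finite sums of squares of
polynomials of degree at most `d`. -/
def sosCone (n d : ℕ) : Set (MvPolynomial (Fin n) ℝ) :=
  {s | ∃ (m : ℕ) (r : Fin m → MvPolynomial (Fin n) ℝ),
    (∀ i, (r i).totalDegree ≤ d) ∧ s = ∑ i, r i ^ 2}

/-- The maximal degree of a finite family of polynomials. -/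
def familyDegree {n : ℕ} {ι : Type*} [Fintype ι] (g : ι → MvPolynomial (Fin n) ℝ) : ℕ :=
  Finset.univ.sup fun i => (g i).totalDegree

/-- `Σ_{n,d}^G`: the polynomials `s₀ + ∑ i, s i * g i` in which every `s i` is a sum of squares
of polynomials of degree at most `d`, and `s₀` is a sum of squares whose own degree is at most
`2 * ⌈(2 * d + deg G) / 2⌉`. -/
def certCone {n : ℕ} {ι : Type*} [Fintype ι] (g : ι → MvPolynomial (Fin n) ℝ) (d : ℕ) :
    Set (MvPolynomial (Fin n) ℝ) :=
  {f | ∃ s₀ ∈ sosCone n ((2 * d + familyDegree g) ⌈/⌉ 2),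
    ∃ s : ι → MvPolynomial (Fin n) ℝ,
      (∀ i, s i ∈ sosCone n d) ∧ f = s₀ + ∑ i, s i * g i}

/-- The Boolean axioms `± (x_i ^ 2 - x_i)`. -/
noncomputable def boolAxioms (n : ℕ) : Fin n ⊕ Fin n → MvPolynomial (Fin n) ℝ :=
  Sum.elim (fun i => X i ^ 2 - X i) (fun i => -(X i ^ 2 - X i))

/-- `f` has a degree `d` SoS certificate of nonnegativity modulo the Boolean axioms. -/
def HasSoSCertificate {n : ℕ} (f : MvPolynomial (Fin n) ℝ) (d : ℕ) : Prop :=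
  f ∈ certCone (boolAxioms n) d

/-- The symmetric quadratic function `q_k(x) = (|x| - k) (|x| - k + 1)`, `|x| = x_1 + ⋯ + x_n`. -/
noncomputable def sqf (n k : ℕ) : MvPolynomial (Fin n) ℝ :=
  ((∑ i, X i) - C (k : ℝ)) * ((∑ i, X i) - C (k : ℝ) + 1)

end BooleanSoS

namespace BooleanSoS

open MvPolynomial

/-! ### The cone of sums of squares -/

/-! On the cube `sqf n k` depends only on t = |x| ∈ {0, …, n}, so the problem is univariate. Write
q_k = P + t(t-1)⋯(t-k)·R, where P = ∑ q_k(j)·C(t, j)·b_j(t)² interpolates q_k at 0, …, k: C(t, j)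
vanishes at the integers below j, b_j at j+1, …, k, and b_j(j)² = 1. On the cube C(t, j) is a sum of
squared monomials of degree j, so P is a sum of squares. If P ≤ q_k on [k+1, n+1], then R ≥ 0 there,
and Lukács' theorem (`intervalSoS_of_nonneg`) expresses R by squares, t-k-1 and n+1-t. Multiplied by
the falling factorial these become sums of squares on the cube (`cubeSoS_fallingPoly_mul`).

The crux is P ≤ q_k (`eval_interpPoly_le`). The interpolating factors may be as large as exp(2 log n
· min(t-j, k)), so b_j also carries a Chebyshev polynomial adapted to [2k, 2k+n] and normalised at
j. At degree M of order √(kn) log n its decay from j to t beats that growth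
(`abs_eval_shiftedChebyshev_le`). Since k ≤ √(kn), M dominates the total degree. Agreement on the
vertices is lifted to a polynomial identity by `exists_eq_sum_mul_boolAxiom`. -/

lemma mem_sosCone_of_fintype {n d : ℕ} {ι : Type*} [Fintype ι]
    (r : ι → MvPolynomial (Fin n) ℝ) (hr : ∀ i, (r i).totalDegree ≤ d) :
    ∑ i, r i ^ 2 ∈ sosCone n d :=
  ⟨Fintype.card ι, fun i => r ((Fintype.equivFin ι).symm i), fun _ => hr _,
    ((Fintype.equivFin ι).symm.sum_comp fun i => r i ^ 2).symm⟩

lemma sq_mem_sosCone {n d : ℕ} {r : MvPolynomial (Fin n) ℝ} (hr : r.totalDegree ≤ d) :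
    r ^ 2 ∈ sosCone n d := by
  simpa using mem_sosCone_of_fintype (fun _ : Unit => r) fun _ => hr

lemma zero_mem_sosCone (n d : ℕ) : (0 : MvPolynomial (Fin n) ℝ) ∈ sosCone n d := by
  simpa using mem_sosCone_of_fintype (fun i : Empty => (i.elim : MvPolynomial (Fin n) ℝ))
    fun i => i.elim

lemma sosCone_mono {n d e : ℕ} (h : d ≤ e) : sosCone n d ⊆ sosCone n e := by
  rintro _ ⟨m, r, hr, rfl⟩
  exact ⟨m, r, fun i => (hr i).trans h, rfl⟩

lemma add_mem_sosCone {n d : ℕ} {s t : MvPolynomial (Fin n) ℝ} (hs : s ∈ sosCone n d)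
    (ht : t ∈ sosCone n d) : s + t ∈ sosCone n d := by
  obtain ⟨m, r, hr, rfl⟩ := hs
  obtain ⟨m', r', hr', rfl⟩ := ht
  have := mem_sosCone_of_fintype (d := d) (Sum.elim r r') (by rintro (i | i) <;> simp [hr, hr'])
  simpa using this

lemma mul_mem_sosCone {n d e : ℕ} {s t : MvPolynomial (Fin n) ℝ} (hs : s ∈ sosCone n d)
    (ht : t ∈ sosCone n e) : s * t ∈ sosCone n (d + e) := by
  obtain ⟨m, r, hr, rfl⟩ := hs
  obtain ⟨m', r', hr', rfl⟩ := ht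
  have := mem_sosCone_of_fintype (d := d + e) (fun p : Fin m × Fin m' => r p.1 * r' p.2)
    fun p => (totalDegree_mul _ _).trans (add_le_add (hr _) (hr' _))
  rw [Finset.sum_mul_sum, ← Finset.sum_product']
  simpa [mul_pow] using this

lemma totalDegree_le_of_mem_sosCone {n d : ℕ} {s : MvPolynomial (Fin n) ℝ}
    (hs : s ∈ sosCone n d) : s.totalDegree ≤ 2 * d := by
  obtain ⟨m, r, hr, rfl⟩ := hs
  refine totalDegree_finsetSum_le fun i _ => (totalDegree_pow _ _).trans ?_
  exact Nat.mul_le_mul_left _ (hr i)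

/-! ### From the Boolean cube to polynomial identities -/

/-- The vertex of the Boolean cube with support `A`. -/
noncomputable def vertex {n : ℕ} (A : Finset (Fin n)) : Fin n → ℝ :=
  fun i => if i ∈ A then 1 else 0

/-- Combinatorial Nullstellensatz on the grid {0, 1}ⁿ; its degree bound concerns the products, hence
also controls the cofactors. -/
lemma exists_eq_sum_mul_boolAxiom {n e : ℕ} {f : MvPolynomial (Fin n) ℝ}
    (hf : f.totalDegree ≤ e) (h0 : ∀ A, eval (vertex A) f = 0) :
    ∃ g : Fin n → MvPolynomial (Fin n) ℝ, (∀ i, (g i).totalDegree ≤ e) ∧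
      f = ∑ i, g i * (X i ^ 2 - X i) := by
  obtain ⟨h, hdeg, hsum⟩ := combinatorial_nullstellensatz_exists_linearCombination
    (fun _ : Fin n => ({0, 1} : Finset ℝ)) (fun _ => by simp) f (by
      intro x hx
      have : x = vertex (Finset.univ.filter fun i => x i = 1) := by
        ext i
        have := hx i
        simp only [Finset.mem_insert, Finset.mem_singleton] at this
        rcases this with h | h <;> simp [vertex, h]
      rw [this, h0])
  have hprod (i : Fin n) : (∏ s ∈ ({0, 1} : Finset ℝ), (X i - C s) : MvPolynomial (Fin n) ℝ)
      = X i ^ 2 - X i := by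
    rw [Finset.prod_pair zero_ne_one]
    simp; ring
  have hne (i : Fin n) : (X i ^ 2 - X i : MvPolynomial (Fin n) ℝ) ≠ 0 := by
    intro h
    have := congrArg (eval fun _ => (2 : ℝ)) h
    norm_num at this
  refine ⟨h, fun i => ?_, ?_⟩
  · by_cases hi : h i = 0
    · simp [hi]
    · have := hdeg i
      rw [hprod, totalDegree_mul_of_isDomain (hne i) hi] at this
      omega
  · nth_rw 1 [hsum]
    rw [Finsupp.linearCombination_apply, Finsupp.sum_fintype _ _ (by simp)]
    simp [hprod]

/-- The cofactors g of f - s have arbitrary sign, but both signs of each axiom are available and g =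
((g+1)/2)² - ((g-1)/2)². The squared polynomials have degree up to 2D, whence the certificate
degree. -/
lemma hasSoSCertificate_of_eval_vertex {n D : ℕ} {f s : MvPolynomial (Fin n) ℝ}
    (hs : s ∈ sosCone n D) (hf : f.totalDegree ≤ 2 * D)
    (h : ∀ A, eval (vertex A) f = eval (vertex A) s) : HasSoSCertificate f (2 * D) := by
  obtain ⟨g, hg, hfg⟩ := exists_eq_sum_mul_boolAxiom (f := f - s) (e := 2 * D)
    ((totalDegree_sub _ _).trans (max_le hf (totalDegree_le_of_mem_sosCone hs)))
    (fun A => by simp [h A])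
  refine ⟨s, sosCone_mono ?_ hs,
    Sum.elim (fun i => (C (1 / 2) * (g i + 1)) ^ 2) (fun i => (C (1 / 2) * (g i - 1)) ^ 2),
    ?_, ?_⟩
  · rw [Nat.ceilDiv_eq_add_pred_div]
    omega
  · have hC (p : MvPolynomial (Fin n) ℝ) (hp : p.totalDegree ≤ 2 * D) :
        (C (1 / 2) * p).totalDegree ≤ 2 * D :=
      (totalDegree_mul _ _).trans (by simpa using hp)
    rintro (i | i) <;> refine sq_mem_sosCone (hC _ ?_)
    · exact (totalDegree_add _ _).trans (max_le (hg i) (by simp))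
    · exact (totalDegree_sub _ _).trans (max_le (hg i) (by simp))
  · rw [Fintype.sum_sum_type, ← Finset.sum_add_distrib, ← sub_eq_iff_eq_add', hfg]
    refine Finset.sum_congr rfl fun i _ => ?_
    have h2 : (C (1 / 2) : MvPolynomial (Fin n) ℝ) ^ 2 * 4 = 1 := by
      rw [show (4 : MvPolynomial (Fin n) ℝ) = C 4 from (map_ofNat C 4).symm, ← C_pow, ← C_mul]
      norm_num
    simp only [boolAxioms, Sum.elim_inl, Sum.elim_inr]
    linear_combination (-(g i * (X i ^ 2 - X i))) * h2

/-! ### Symmetric functions on the cube -/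

/-- The function `A ↦ h #A` on the Boolean cube agrees with a sum of squares of polynomials of
degree at most `D`. -/
def CubeSoS (n D : ℕ) (h : ℕ → ℝ) : Prop :=
  ∃ s ∈ sosCone n D, ∀ A : Finset (Fin n), eval (vertex A) s = h A.card

namespace CubeSoS

variable {n D E : ℕ} {g h : ℕ → ℝ}

lemma mono (hh : CubeSoS n D h) (hDE : D ≤ E) : CubeSoS n E h := by
  obtain ⟨s, hs, hv⟩ := hh
  exact ⟨s, sosCone_mono hDE hs, hv⟩

lemma congr (hh : CubeSoS n D h) (hgh : ∀ m ≤ n, g m = h m) : CubeSoS n D g := by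
  obtain ⟨s, hs, hv⟩ := hh
  refine ⟨s, hs, fun A => (hv A).trans (hgh _ ?_).symm⟩
  simpa using A.card_le_univ

lemma zero (n D : ℕ) : CubeSoS n D fun _ => 0 :=
  ⟨0, zero_mem_sosCone n D, by simp⟩

lemma add (hg : CubeSoS n D g) (hh : CubeSoS n D h) : CubeSoS n D fun m => g m + h m := by
  obtain ⟨s, hs, hv⟩ := hg
  obtain ⟨t, ht, hw⟩ := hh
  exact ⟨s + t, add_mem_sosCone hs ht, by simp [hv, hw]⟩

lemma sum {ι : Type*} (S : Finset ι) {g : ι → ℕ → ℝ} (hg : ∀ i ∈ S, CubeSoS n D (g i)) :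
    CubeSoS n D fun m => ∑ i ∈ S, g i m := by
  classical
  induction S using Finset.induction_on with
  | empty => simpa using zero n D
  | insert a S ha ih =>
    simp only [Finset.sum_insert ha]
    exact (hg a (by simp)).add (ih fun i hi => hg i (by simp [hi]))

lemma mul (hg : CubeSoS n D g) (hh : CubeSoS n E h) : CubeSoS n (D + E) fun m => g m * h m := by
  obtain ⟨s, hs, hv⟩ := hg
  obtain ⟨t, ht, hw⟩ := hh
  exact ⟨s * t, mul_mem_sosCone hs ht, by simp [hv, hw]⟩

lemma const {c : ℝ} (hc : 0 ≤ c) (n D : ℕ) : CubeSoS n D fun _ => c :=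
  ⟨C (√c) ^ 2, sq_mem_sosCone (by simp), by simp [Real.sq_sqrt hc]⟩

lemma sum_vertex (A : Finset (Fin n)) : ∑ i, vertex A i = A.card := by
  simp [vertex]

lemma sq_eval (p : Polynomial ℝ) (n : ℕ) :
    CubeSoS n p.natDegree fun m => p.eval (m : ℝ) ^ 2 := by
  refine ⟨(Polynomial.aeval (∑ i, X i) p) ^ 2, sq_mem_sosCone ?_, fun A => ?_⟩
  · rw [Polynomial.aeval_eq_sum_range]
    refine totalDegree_finsetSum_le fun i hi => (totalDegree_smul_le _ _).trans ?_
    refine (totalDegree_pow _ _).trans ?_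
    calc i * (∑ i : Fin n, X i : MvPolynomial (Fin n) ℝ).totalDegree ≤ i * 1 :=
          Nat.mul_le_mul_left _ (totalDegree_finsetSum_le fun i _ => (totalDegree_X i).le)
      _ ≤ _ := by simp at hi; omega
  · rw [map_pow, Polynomial.aeval_def, Polynomial.hom_eval₂]
    have : (eval (vertex A)).comp (algebraMap ℝ (MvPolynomial (Fin n) ℝ)) = RingHom.id ℝ := by
      ext; simp
    rw [this]
    simp [sum_vertex]

/-- C(|x|, j) is the sum of the multilinear monomials of degree j, and each equals its own square on
the cube. -/
lemma choose (n j : ℕ) : CubeSoS n j fun m => (m.choose j : ℝ) := by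
  classical
  refine ⟨∑ S : Finset.powersetCard j (Finset.univ : Finset (Fin n)), (∏ i ∈ S.1, X i) ^ 2,
    mem_sosCone_of_fintype _ fun S => ?_, fun A => ?_⟩
  · refine (totalDegree_finsetProd _ _).trans ?_
    have := (Finset.mem_powersetCard.1 S.2).2
    simp [totalDegree_X, this]
  · have hS (S : Finset (Fin n)) : (∏ i ∈ S, vertex A i) ^ 2 = if S ⊆ A then 1 else 0 := by
      split_ifs with h
      · rw [Finset.prod_congr rfl fun i hi => by rw [vertex, if_pos (h hi)]]
        simp
      · obtain ⟨i, hi, hiA⟩ := Finset.not_subset.1 h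
        rw [Finset.prod_eq_zero hi (by simp [vertex, hiA])]
        simp
    simp only [map_sum, map_pow, map_prod, eval_X, hS]
    rw [Finset.sum_coe_sort (Finset.powersetCard j Finset.univ)
      (fun S => if S ⊆ A then (1 : ℝ) else 0), Finset.sum_boole, ← Finset.card_powersetCard]
    congr 2
    ext S
    simp [Finset.mem_powersetCard, and_comm]

lemma complement (n : ℕ) : CubeSoS n 1 fun m => (n : ℝ) - m := by
  refine ⟨∑ i, (1 - X i) ^ 2, mem_sosCone_of_fintype _ fun i => ?_, fun A => ?_⟩
  · exact (totalDegree_sub _ _).trans (by simp [totalDegree_X])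
  · have h (i : Fin n) : (1 - vertex A i) ^ 2 = 1 - vertex A i := by
      unfold vertex
      split_ifs <;> norm_num
    simp [h, Finset.sum_sub_distrib, sum_vertex]

end CubeSoS

end BooleanSoS

namespace BooleanSoS

open Polynomial

/-! ### Polynomials that are nonnegative on an interval -/

/-- Sums of squares of univariate real polynomials of degree at most `D`. -/
noncomputable def sqClosure (D : ℕ) : AddSubmonoid ℝ[X] :=
  AddSubmonoid.closure {s | ∃ r : ℝ[X], r.natDegree ≤ D ∧ s = r ^ 2}

lemma sq_mem_sqClosure {D : ℕ} {r : ℝ[X]} (h : r.natDegree ≤ D) : r ^ 2 ∈ sqClosure D :=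
  AddSubmonoid.subset_closure ⟨r, h, rfl⟩

lemma sq_mul_mem_sqClosure {D e : ℕ} {q s : ℝ[X]} (hq : q.natDegree ≤ e)
    (hs : s ∈ sqClosure D) : q ^ 2 * s ∈ sqClosure (D + e) := by
  induction hs using AddSubmonoid.closure_induction with
  | mem x hx =>
    obtain ⟨r, hr, rfl⟩ := hx
    rw [← mul_pow]
    exact sq_mem_sqClosure (natDegree_mul_le.trans (by omega))
  | zero => simp
  | add x y _ _ hx hy => rw [mul_add]; exact add_mem hx hy

lemma sqClosure_mono {D E : ℕ} (h : D ≤ E) : sqClosure D ≤ sqClosure E :=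
  AddSubmonoid.closure_mono fun _ ⟨r, hr, hs⟩ => ⟨r, hr.trans h, hs⟩

lemma C_mul_mem_sqClosure {D : ℕ} {c : ℝ} (hc : 0 ≤ c) {s : ℝ[X]} (hs : s ∈ sqClosure D) :
    C c * s ∈ sqClosure D := by
  have := sq_mul_mem_sqClosure (q := C √c) (e := 0) (by simp) hs
  rwa [← C_pow, Real.sq_sqrt hc] at this

/-- The degree `D` part of the preordering generated by `X - a` and `b - X`. -/
def IntervalSoS (a b : ℝ) (D : ℕ) (p : ℝ[X]) : Prop :=
  ∃ s₀ ∈ sqClosure D, ∃ s₁ ∈ sqClosure D, ∃ s₂ ∈ sqClosure D, ∃ s₃ ∈ sqClosure D,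
    p = s₀ + (X - C a) * s₁ + (C b - X) * s₂ + (X - C a) * (C b - X) * s₃

namespace IntervalSoS

variable {a b : ℝ} {D : ℕ} {p q : ℝ[X]}

lemma mono {E : ℕ} (h : D ≤ E) (hp : IntervalSoS a b D p) : IntervalSoS a b E p := by
  obtain ⟨s₀, h₀, s₁, h₁, s₂, h₂, s₃, h₃, rfl⟩ := hp
  have := sqClosure_mono h
  exact ⟨s₀, this h₀, s₁, this h₁, s₂, this h₂, s₃, this h₃, rfl⟩

lemma add (hp : IntervalSoS a b D p) (hq : IntervalSoS a b D q) :
    IntervalSoS a b D (p + q) := by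
  obtain ⟨s₀, h₀, s₁, h₁, s₂, h₂, s₃, h₃, rfl⟩ := hp
  obtain ⟨t₀, k₀, t₁, k₁, t₂, k₂, t₃, k₃, rfl⟩ := hq
  exact ⟨s₀ + t₀, add_mem h₀ k₀, s₁ + t₁, add_mem h₁ k₁, s₂ + t₂, add_mem h₂ k₂,
    s₃ + t₃, add_mem h₃ k₃, by ring⟩

lemma const_mul {c : ℝ} (hc : 0 ≤ c) (hp : IntervalSoS a b D p) :
    IntervalSoS a b D (C c * p) := by
  obtain ⟨s₀, h₀, s₁, h₁, s₂, h₂, s₃, h₃, rfl⟩ := hp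
  exact ⟨C c * s₀, C_mul_mem_sqClosure hc h₀, C c * s₁, C_mul_mem_sqClosure hc h₁,
    C c * s₂, C_mul_mem_sqClosure hc h₂, C c * s₃, C_mul_mem_sqClosure hc h₃, by ring⟩

lemma sq_mul {e : ℕ} (hq : q.natDegree ≤ e) (hp : IntervalSoS a b D p) :
    IntervalSoS a b (D + e) (q ^ 2 * p) := by
  obtain ⟨s₀, h₀, s₁, h₁, s₂, h₂, s₃, h₃, rfl⟩ := hp
  exact ⟨q ^ 2 * s₀, sq_mul_mem_sqClosure hq h₀, q ^ 2 * s₁, sq_mul_mem_sqClosure hq h₁,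
    q ^ 2 * s₂, sq_mul_mem_sqClosure hq h₂, q ^ 2 * s₃, sq_mul_mem_sqClosure hq h₃, by ring⟩

/-- Multiplication by X - a swaps the four generators in pairs, up to a factor (X - a)² absorbed
into the squares. -/
lemma left_mul (hp : IntervalSoS a b D p) : IntervalSoS a b (D + 1) ((X - C a) * p) := by
  obtain ⟨s₀, h₀, s₁, h₁, s₂, h₂, s₃, h₃, rfl⟩ := hp
  have hd : (X - C a : ℝ[X]).natDegree ≤ 1 := (natDegree_X_sub_C a).le
  have hm := sqClosure_mono (Nat.le_add_right D 1)
  exact ⟨(X - C a) ^ 2 * s₁, sq_mul_mem_sqClosure hd h₁, s₀, hm h₀, (X - C a) ^ 2 * s₃,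
    sq_mul_mem_sqClosure hd h₃, s₂, hm h₂, by ring⟩

lemma right_mul (hp : IntervalSoS a b D p) : IntervalSoS a b (D + 1) ((C b - X) * p) := by
  obtain ⟨s₀, h₀, s₁, h₁, s₂, h₂, s₃, h₃, rfl⟩ := hp
  have hd : (C b - X : ℝ[X]).natDegree ≤ 1 := by
    rw [← neg_sub, natDegree_neg]; exact (natDegree_X_sub_C b).le
  have hm := sqClosure_mono (Nat.le_add_right D 1)
  exact ⟨(C b - X) ^ 2 * s₂, sq_mul_mem_sqClosure hd h₂, (C b - X) ^ 2 * s₃,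
    sq_mul_mem_sqClosure hd h₃, s₀, hm h₀, s₁, hm h₁, by ring⟩

end IntervalSoS

/-- After dividing out a factor that vanishes at r, the sign of the quotient at r is recovered by
continuity. -/
lemma eval_nonneg_Icc_of_punctured {a b : ℝ} (hab : a < b) {q : ℝ[X]} (r : ℝ)
    (h : ∀ x ∈ Set.Icc a b, x ≠ r → 0 ≤ q.eval x) : ∀ x ∈ Set.Icc a b, 0 ≤ q.eval x := by
  have hcl : IsClosed {x : ℝ | 0 ≤ q.eval x} := isClosed_le continuous_const q.continuous
  have hsub : Set.Ioo a b ∩ {r}ᶜ ⊆ {x : ℝ | 0 ≤ q.eval x} := fun x hx =>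
    h x (Set.Ioo_subset_Icc_self hx.1) hx.2
  have hd : Set.Ioo a b ⊆ closure (Set.Ioo a b ∩ {r}ᶜ) := by
    have : Dense ({r}ᶜ : Set ℝ) := dense_compl_singleton r
    exact this.open_subset_closure_inter isOpen_Ioo
  intro x hx
  have h1 : x ∈ closure (Set.Ioo a b) := by rwa [closure_Ioo hab.ne]
  have h2 := closure_minimal hd isClosed_closure h1
  exact closure_minimal hsub hcl h2

/-- Lukács' theorem, with a crude degree bound. -/
theorem intervalSoS_of_nonneg {a b : ℝ} (hab : a < b) (p : ℝ[X])
    (hp : ∀ x ∈ Set.Icc a b, 0 ≤ p.eval x) : IntervalSoS a b p.natDegree p := by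
  induction hN : p.natDegree using Nat.strong_induction_on generalizing p with
  | _ N ih =>
  rcases Nat.eq_zero_or_pos N with h0 | hpos
  · subst h0
    obtain ⟨c, rfl⟩ : ∃ c, p = C c := ⟨_, eq_C_of_natDegree_eq_zero hN⟩
    have hc : 0 ≤ c := by simpa using hp a ⟨le_rfl, hab.le⟩
    refine ⟨C c, ?_, 0, zero_mem _, 0, zero_mem _, 0, zero_mem _, by simp⟩
    have := sq_mem_sqClosure (D := 0) (r := C √c) (by simp)
    rwa [← C_pow, Real.sq_sqrt hc] at this
  have hp0 : p ≠ 0 := by rintro rfl; simp at hN; omega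
  -- splitting off a factor that is positive away from one point
  have key (g q : ℝ[X]) (r : ℝ) (hpq : p = g * q)
      (hg : ∀ x ∈ Set.Icc a b, x ≠ r → 0 < g.eval x) (hgd : 0 < g.natDegree) :
      IntervalSoS a b (N - g.natDegree) q ∧ g.natDegree ≤ N := by
    have hgq : g ≠ 0 ∧ q ≠ 0 := by
      rw [hpq] at hp0; exact ⟨left_ne_zero_of_mul hp0, right_ne_zero_of_mul hp0⟩
    have hdeg : N = g.natDegree + q.natDegree := by
      rw [← hN, hpq, natDegree_mul hgq.1 hgq.2]
    refine ⟨?_, by omega⟩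
    have := ih q.natDegree (by omega) q ?_ rfl
    · rwa [show N - g.natDegree = q.natDegree by omega]
    · refine eval_nonneg_Icc_of_punctured hab r fun x hx hxr => ?_
      have h1 := hp x hx
      rw [hpq, eval_mul] at h1
      exact nonneg_of_mul_nonneg_right h1 (hg x hx hxr)
  -- Peel off a complex root. A real root outside (a, b) gives a linear factor X - r = (X - a) + (a
  -- - r) or its mirror image; an interior one is double because p has a local minimum there; a
  -- nonreal one gives a square plus a positive constant.
  obtain ⟨z, hz⟩ : ∃ z : ℂ, aeval z p = 0 := by
    refine IsAlgClosed.exists_aeval_eq_zero ℂ p ?_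
    rw [degree_eq_natDegree hp0, hN]
    exact_mod_cast hpos.ne'
  by_cases him : z.im = 0
  · obtain ⟨r, rfl⟩ : ∃ r : ℝ, z = r := ⟨z.re, Complex.ext rfl (by simpa using him)⟩
    have hr : p.eval r = 0 := by
      have : (aeval (algebraMap ℝ ℂ r)) p = 0 := hz
      rw [aeval_algebraMap_apply] at this
      simpa using this
    rcases le_or_gt r a with hra | hra
    · obtain ⟨q, hq⟩ := dvd_iff_isRoot.2 hr
      obtain ⟨hI, hle⟩ := key (X - C r) q r hq (fun x hx hxr => by
        simp only [eval_sub, eval_X, eval_C, sub_pos]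
        exact lt_of_le_of_ne (hra.trans hx.1) hxr.symm) (by simp)
      rw [natDegree_X_sub_C] at hI hle
      have := hI.left_mul.add ((hI.const_mul (sub_nonneg.2 hra)).mono (Nat.le_add_right _ 1))
      rw [Nat.sub_add_cancel hle] at this
      convert this using 1
      rw [hq, C_sub]; ring
    rcases le_or_gt b r with hrb | hrb
    · obtain ⟨q, hq⟩ := dvd_iff_isRoot.2 hr
      have hd : (C r - X : ℝ[X]).natDegree = 1 := by
        rw [← neg_sub, natDegree_neg, natDegree_X_sub_C]
      obtain ⟨hI, hle⟩ := key (C r - X) (-q) r (by rw [hq]; ring) (fun x hx hxr => by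
        simp only [eval_sub, eval_X, eval_C, sub_pos]
        exact lt_of_le_of_ne (hx.2.trans hrb) hxr) (by simp [hd])
      rw [hd] at hI hle
      have := hI.right_mul.add ((hI.const_mul (sub_nonneg.2 hrb)).mono (Nat.le_add_right _ 1))
      rw [Nat.sub_add_cancel hle] at this
      convert this using 1
      rw [hq, C_sub]; ring
    · have hder : p.derivative.eval r = 0 := by
        have hmin : IsLocalMin (fun x => p.eval x) r := by
          filter_upwards [Icc_mem_nhds hra hrb] with x hx
          rw [hr]; exact hp x hx
        simpa using hmin.deriv_eq_zero
      have hdvd : (X - C r) ^ 2 ∣ p := by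
        rw [← le_rootMultiplicity_iff hp0]
        exact (one_lt_rootMultiplicity_iff_isRoot hp0).2 ⟨hr, hder⟩
      obtain ⟨q, hq⟩ := hdvd
      have hd : ((X - C r) ^ 2 : ℝ[X]).natDegree = 2 := by simp
      obtain ⟨hI, hle⟩ := key _ q r hq (fun x hx hxr => by
        simp only [eval_pow, eval_sub, eval_X, eval_C]
        have := sub_ne_zero.2 hxr
        positivity) (by rw [hd]; norm_num)
      rw [hd] at hI hle
      rw [hq]
      exact (hI.sq_mul (natDegree_X_sub_C r).le).mono (by omega)
  · obtain ⟨q, hq⟩ := quadratic_dvd_of_aeval_eq_zero_im_ne_zero p hz him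
    have hquad : (X ^ 2 - C (2 * z.re) * X + C (‖z‖ ^ 2) : ℝ[X])
        = (X - C z.re) ^ 2 + C (z.im ^ 2) := by
      rw [← Complex.normSq_eq_norm_sq, Complex.normSq_apply]
      simp only [C_add, C_mul, C_pow, map_ofNat]
      ring
    rw [hquad] at hq
    have hd : ((X - C z.re) ^ 2 + C (z.im ^ 2) : ℝ[X]).natDegree = 2 := by
      rw [natDegree_add_C]; simp
    -- The factor is positive everywhere; a - 1 is a dummy exceptional point.
    obtain ⟨hI, hle⟩ := key _ q (a - 1) hq (fun x hx hxr => by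
      simp only [eval_add, eval_pow, eval_sub, eval_X, eval_C]
      positivity) (by rw [hd]; norm_num)
    rw [hd] at hI hle
    rw [hq, add_mul]
    exact ((hI.sq_mul (natDegree_X_sub_C z.re).le).mono (by omega)).add
      ((hI.const_mul (sq_nonneg _)).mono (by omega))

end BooleanSoS

namespace BooleanSoS

open Polynomial

/-! ### Decay of Chebyshev polynomials -/

lemma half_sub_le_arsinh_sub {x y : ℝ} (hx : 0 ≤ x) (hxy : x ≤ y) (hy : y ^ 2 ≤ 3) :
    (y - x) / 2 ≤ Real.arsinh y - Real.arsinh x := by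
  have h := (convex_Icc x y).mul_sub_le_image_sub_of_le_deriv (f := Real.arsinh) (C := 1 / 2)
    Real.continuous_arsinh.continuousOn Real.differentiable_arsinh.differentiableOn
    (fun u hu => by
      rw [interior_Icc] at hu
      rw [(Real.hasDerivAt_arsinh u).deriv, one_div]
      have h1 : √(1 + u ^ 2) ≤ 2 := by
        rw [Real.sqrt_le_left (by norm_num)]
        nlinarith [hu.1, hu.2]
      gcongr) x ⟨le_rfl, hxy⟩ y ⟨hxy, le_rfl⟩ hxy
  linarith

/-- With sinh θ = √a, 1 + 2a = cosh 2θ. -/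
lemma eval_chebyshev_one_add_two_mul (M : ℕ) {a : ℝ} (ha : 0 ≤ a) :
    (Chebyshev.T ℝ M).eval (1 + 2 * a) = Real.cosh (M * (2 * Real.arsinh √a)) := by
  have h : 1 + 2 * a = Real.cosh (2 * Real.arsinh √a) := by
    rw [Real.cosh_two_mul, Real.cosh_arsinh, Real.sinh_arsinh, Real.sq_sqrt ha,
      Real.sq_sqrt (by linarith)]
    ring
  rw [h, Chebyshev.T_real_cosh]
  simp

lemma eval_chebyshev_pos (M : ℕ) {a : ℝ} (ha : 0 ≤ a) :
    0 < (Chebyshev.T ℝ M).eval (1 + 2 * a) := by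
  rw [eval_chebyshev_one_add_two_mul M ha]
  exact Real.cosh_pos _

/-- To the right of 1, T_M(1 + 2b) grows like exp(2M arsinh √b). The exponent drops between b and a
by at least M(√b - √a), and √b - √a ≥ (b - a)/(2√b). The bound b ≤ 3 keeps the derivative of arsinh
at least 1/2. -/
lemma abs_eval_chebyshev_le (M : ℕ) {a b δ E : ℝ} (ha : -1 ≤ a) (hb : 0 < b) (hb3 : b ≤ 3)
    (hδ : 0 ≤ δ) (hδa : δ ≤ b - a) (hδb : δ ≤ b) (hE : E ≤ M * (δ / (2 * √b))) :
    |(Chebyshev.T ℝ M).eval (1 + 2 * a)| ≤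
      2 * Real.exp (-E) * (Chebyshev.T ℝ M).eval (1 + 2 * b) := by
  -- For a < 0 the argument lies in [-1, 1], where |T_M| ≤ 1, the same bound as at a = 0.
  set a₀ := max a 0 with ha₀
  have ha₀0 : 0 ≤ a₀ := le_max_right _ _
  have hδ₀ : δ ≤ b - a₀ := by
    rcases max_cases a 0 with h | h <;> rw [ha₀, h.1] <;> linarith
  have hab : a₀ ≤ b := by linarith
  have hupper : |(Chebyshev.T ℝ M).eval (1 + 2 * a)| ≤
      Real.exp (M * (2 * Real.arsinh √a₀)) := by
    rcases le_total 0 a with h | h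
    · rw [ha₀, max_eq_left h, eval_chebyshev_one_add_two_mul M h, abs_of_pos (Real.cosh_pos _),
        Real.cosh_eq]
      have : 0 ≤ (M : ℝ) * (2 * Real.arsinh √a) := by
        have := Real.arsinh_nonneg_iff.2 (Real.sqrt_nonneg a)
        positivity
      have := Real.exp_le_exp.2 (neg_le_self this)
      linarith
    · rw [ha₀, max_eq_right h]
      simp only [Real.sqrt_zero, Real.arsinh_zero, mul_zero, Real.exp_zero]
      exact Chebyshev.abs_eval_T_real_le_one _ (abs_le.2 ⟨by linarith, by linarith⟩)
  have hlower : Real.exp (M * (2 * Real.arsinh √b)) ≤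
      2 * (Chebyshev.T ℝ M).eval (1 + 2 * b) := by
    rw [eval_chebyshev_one_add_two_mul M hb.le, Real.cosh_eq]
    have := Real.exp_pos (-(M * (2 * Real.arsinh √b)))
    linarith
  have hang : δ / (2 * √b) ≤ 2 * Real.arsinh √b - 2 * Real.arsinh √a₀ := by
    have hsq := Real.sqrt_le_sqrt hab
    have h1 := half_sub_le_arsinh_sub (Real.sqrt_nonneg a₀) hsq (by rwa [Real.sq_sqrt hb.le])
    have hb' : 0 < √b := Real.sqrt_pos.2 hb
    have h2 : δ / (2 * √b) ≤ √b - √a₀ := by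
      rw [div_le_iff₀ (by positivity)]
      nlinarith [Real.sq_sqrt hb.le, Real.sq_sqrt ha₀0, sq_nonneg (√b - √a₀)]
    linarith
  have hexp : (M : ℝ) * (2 * Real.arsinh √a₀) ≤ -E + M * (2 * Real.arsinh √b) := by
    have := mul_le_mul_of_nonneg_left hang (Nat.cast_nonneg (α := ℝ) M)
    linarith
  calc _ ≤ Real.exp (M * (2 * Real.arsinh √a₀)) := hupper
    _ ≤ Real.exp (-E) * Real.exp (M * (2 * Real.arsinh √b)) := by
      rw [← Real.exp_add]; exact Real.exp_le_exp.2 hexp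
    _ ≤ Real.exp (-E) * (2 * (Chebyshev.T ℝ M).eval (1 + 2 * b)) := by gcongr
    _ = _ := by ring

/-- The Chebyshev polynomial of degree `M` transplanted to `[2 * k, 2 * k + n]`. -/
noncomputable def shiftedChebyshev (n k M : ℕ) : ℝ[X] :=
  (Chebyshev.T ℝ M).comp (C (1 + 2 * (2 * k / n) : ℝ) + C (-(2 / n) : ℝ) * X)

lemma eval_shiftedChebyshev (n k M : ℕ) (t : ℝ) :
    (shiftedChebyshev n k M).eval t = (Chebyshev.T ℝ M).eval (1 + 2 * ((2 * k - t) / n)) := by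
  rw [shiftedChebyshev, eval_comp]
  congr 1
  simp only [eval_add, eval_mul, eval_C, eval_X]
  ring

lemma natDegree_shiftedChebyshev_le (n k M : ℕ) : (shiftedChebyshev n k M).natDegree ≤ M := by
  refine natDegree_comp_le.trans ?_
  rw [Chebyshev.natDegree_T]
  have h : (C (1 + 2 * (2 * k / n) : ℝ) + C (-(2 / n) : ℝ) * X).natDegree ≤ 1 := by
    compute_degree
  simpa using Nat.mul_le_mul_left M h

lemma eval_shiftedChebyshev_pos (n M : ℕ) {k : ℕ} {t : ℝ} (ht : t ≤ 2 * k) :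
    0 < (shiftedChebyshev n k M).eval t := by
  rw [eval_shiftedChebyshev]
  exact eval_chebyshev_pos M (div_nonneg (by linarith) (by positivity))

/-- Starting the oscillation interval at 2k puts every j < k at relative distance b = (2k - j)/n
between k/n and 2k/n. A step μ/n then gains Mμ/(2n√b) ≥ Mμ/(2√(2kn)), which explains the size of M.
-/
lemma abs_eval_shiftedChebyshev_le {n k M : ℕ} {E₀ μ j t : ℝ} (hn : 0 < n) (hk : 2 * k ≤ n + 1)
    (hM : 2 * E₀ * √(2 * (k * n)) ≤ M) (hE : 0 ≤ E₀) (hμ : 0 ≤ μ) (hj0 : 0 ≤ j) (hjk : j < k)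
    (hμt : μ ≤ t - j) (hμk : μ ≤ k) (ht : t ≤ n + 2 * k) :
    |(shiftedChebyshev n k M).eval t| ≤
      2 * Real.exp (-(E₀ * μ)) * (shiftedChebyshev n k M).eval j := by
  have hn' : (1 : ℝ) ≤ n := by exact_mod_cast hn
  have hn0 : (0 : ℝ) < n := by linarith
  have hk' : (2 * k : ℝ) ≤ n + 1 := by exact_mod_cast hk
  have hk0 : (0 : ℝ) < k := by linarith
  rw [eval_shiftedChebyshev, eval_shiftedChebyshev]
  have hb : 0 < (2 * k - j) / n := div_pos (by linarith) hn0
  refine abs_eval_chebyshev_le M (δ := μ / n) ?_ hb ?_ (by positivity) ?_ ?_ ?_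
  · rw [le_div_iff₀ hn0]; linarith
  · rw [div_le_iff₀ hn0]; linarith
  · rw [← sub_div]; gcongr; linarith
  · gcongr; linarith
  · have h1 : √((2 * k - j) / n) ≤ √(2 * (k * n)) / n := by
      rw [Real.sqrt_le_left (by positivity), div_pow, Real.sq_sqrt (by positivity),
        div_le_div_iff₀ hn0 (by positivity)]
      nlinarith [mul_pos hn0 hn0]
    have h2 : 0 < √((2 * k - j) / n) := Real.sqrt_pos.2 hb
    rw [← mul_div_assoc, le_div_iff₀ (by positivity)]
    calc E₀ * μ * (2 * √((2 * k - j) / n)) ≤ E₀ * μ * (2 * (√(2 * (k * n)) / n)) := by gcongr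
      _ = (2 * E₀ * √(2 * (k * n))) * (μ / n) := by ring
      _ ≤ M * (μ / n) := by gcongr

/-! ### Interpolation at the points `0, …, k` -/

/-- The polynomial taking the value `m.choose j` at `m`. -/
noncomputable def choosePoly (j : ℕ) : ℝ[X] :=
  ∏ i ∈ Finset.range j, (C (1 / ((i : ℝ) + 1)) * (X - C (j : ℝ)) + 1)

lemma eval_choosePoly (j : ℕ) (t : ℝ) :
    (choosePoly j).eval t = ∏ i ∈ Finset.range j, (1 + (t - j) / ((i : ℝ) + 1)) := by
  rw [choosePoly, eval_prod]
  refine Finset.prod_congr rfl fun i _ => ?_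
  simp; ring

lemma eval_choosePoly_natCast (j m : ℕ) : (choosePoly j).eval (m : ℝ) = m.choose j := by
  rw [eval_choosePoly]
  rcases lt_or_ge m j with h | h
  · rw [Nat.choose_eq_zero_of_lt h, Nat.cast_zero]
    refine Finset.prod_eq_zero (i := j - m - 1) (by simp; omega) ?_
    have : ((j - m - 1 : ℕ) : ℝ) + 1 = j - m := by
      rw [← Nat.cast_add_one, ← Nat.cast_sub h.le]; congr 1; omega
    rw [this]
    have : (j : ℝ) - m ≠ 0 := by
      have : (m : ℝ) < j := by exact_mod_cast h
      linarith
    field_simp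
    ring
  · obtain ⟨s, rfl⟩ := Nat.exists_eq_add_of_le h
    have h0 : ((j + s : ℕ) : ℝ) - j = s := by push_cast; ring
    rw [h0]
    clear h h0
    induction j with
    | zero => simp
    | succ j ih =>
      rw [Finset.prod_range_succ, ih]
      have := Nat.add_one_mul_choose_eq (j + s) j
      have h2 : ((j + s : ℕ) + 1 : ℝ) * (j + s).choose j = (j + s + 1).choose (j + 1) * (j + 1) := by
        exact_mod_cast this
      rw [show j + 1 + s = j + s + 1 by ring, one_add_div (by positivity), mul_div_assoc',
        div_eq_iff (by positivity), ← h2]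
      push_cast; ring

/-- A polynomial vanishing at `j + 1, …, k` and equal to `± 1` at `j`. -/
noncomputable def gapPoly (k j : ℕ) : ℝ[X] :=
  ∏ i ∈ Finset.range (k - j), (C (1 / ((i : ℝ) + 1)) * (X - C (j : ℝ)) - 1)

lemma eval_gapPoly (k j : ℕ) (t : ℝ) :
    (gapPoly k j).eval t = ∏ i ∈ Finset.range (k - j), ((t - j) / ((i : ℝ) + 1) - 1) := by
  rw [gapPoly, eval_prod]
  refine Finset.prod_congr rfl fun i _ => ?_
  simp; ring

lemma eval_gapPoly_self_sq (k j : ℕ) : (gapPoly k j).eval (j : ℝ) ^ 2 = 1 := by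
  rw [eval_gapPoly]
  simp [← pow_mul]

lemma eval_gapPoly_eq_zero {k j i : ℕ} (hji : j < i) (hik : i ≤ k) :
    (gapPoly k j).eval (i : ℝ) = 0 := by
  rw [eval_gapPoly]
  refine Finset.prod_eq_zero (i := i - j - 1) (by simp; omega) ?_
  have h1 : ((i - j - 1 : ℕ) : ℝ) + 1 = i - j := by
    rw [← Nat.cast_add_one, ← Nat.cast_sub hji.le]; congr 1; omega
  have h2 : (i : ℝ) - j ≠ 0 := by
    have : (j : ℝ) < i := by exact_mod_cast hji
    linarith
  rw [h1, div_self h2, sub_self]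

lemma natDegree_prod_affine_le (m : ℕ) (f : ℕ → ℝ[X]) (hf : ∀ i, (f i).natDegree ≤ 1) :
    (∏ i ∈ Finset.range m, f i).natDegree ≤ m := by
  refine (natDegree_prod_le _ _).trans ((Finset.sum_le_sum fun i _ => hf i).trans ?_)
  simp

lemma natDegree_choosePoly_le (j : ℕ) : (choosePoly j).natDegree ≤ j :=
  natDegree_prod_affine_le _ _ fun i => by compute_degree

lemma natDegree_gapPoly_le (k j : ℕ) : (gapPoly k j).natDegree ≤ k - j :=
  natDegree_prod_affine_le _ _ fun i => by compute_degree

/-- Two regimes: for s ≤ k, 1 + x ≤ exp x and the harmonic sum give exp(s(1 + log n)); for s ≥ k,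
each of at most k factors is at most 1 + s ≤ n². The minimum matches the Chebyshev decay. -/
lemma prod_one_add_div_le {n k m : ℕ} {s : ℝ} (hn : 3 ≤ n) (hk : k ≤ n) (hm : m ≤ k)
    (hs : 0 ≤ s) (hsn : s ≤ n + 1) :
    ∏ i ∈ Finset.range m, (1 + s / ((i : ℝ) + 1)) ≤ Real.exp (2 * Real.log n * min s k) := by
  have hn' : (3 : ℝ) ≤ n := by exact_mod_cast hn
  have hL : 1 ≤ Real.log n := by
    rw [Real.le_log_iff_exp_le (by linarith)]
    linarith [Real.exp_one_lt_d9]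
  rcases min_cases s (k : ℝ) with ⟨h, -⟩ | ⟨h, -⟩ <;> rw [h]
  · calc _ ≤ ∏ i ∈ Finset.range m, Real.exp (s / ((i : ℝ) + 1)) :=
        Finset.prod_le_prod (fun i _ => by positivity) fun i _ => by
          linarith [Real.add_one_le_exp (s / ((i : ℝ) + 1))]
      _ = Real.exp (s * harmonic m) := by
        rw [← Real.exp_sum, harmonic]
        push_cast
        rw [Finset.mul_sum]
        rfl
      _ ≤ _ := by
        refine Real.exp_le_exp.2 ?_
        have h1 := harmonic_le_one_add_log m
        have h2 : Real.log m ≤ Real.log n := by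
          rcases Nat.eq_zero_or_pos m with rfl | h0
          · simp only [Nat.cast_zero, Real.log_zero]; linarith
          · exact Real.log_le_log (by exact_mod_cast h0) (by exact_mod_cast hm.trans hk)
        nlinarith
  · have hn2 : 1 + s ≤ Real.exp (2 * Real.log n) := by
      rw [two_mul, Real.exp_add, Real.exp_log (by linarith)]
      nlinarith
    calc _ ≤ ∏ i ∈ Finset.range m, (1 + s) :=
        Finset.prod_le_prod (fun i _ => by positivity) fun i _ => by
          have : s / ((i : ℝ) + 1) ≤ s := div_le_self hs (by linarith [Nat.cast_nonneg (α := ℝ) i])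
          linarith
      _ = (1 + s) ^ m := by simp
      _ ≤ (1 + s) ^ k := pow_le_pow_right₀ (by linarith) hm
      _ ≤ Real.exp (2 * Real.log n) ^ k := by gcongr
      _ = _ := by rw [← Real.exp_nat_mul]; ring_nf

lemma abs_eval_gapPoly_le (k j : ℕ) {t : ℝ} (ht : j ≤ t) :
    |(gapPoly k j).eval t| ≤ ∏ i ∈ Finset.range (k - j), (1 + (t - j) / ((i : ℝ) + 1)) := by
  rw [eval_gapPoly, Finset.abs_prod]
  refine Finset.prod_le_prod (fun _ _ => abs_nonneg _) fun i _ => ?_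
  have : 0 ≤ (t - j) / ((i : ℝ) + 1) := div_nonneg (by linarith) (by positivity)
  exact abs_le.2 ⟨by linarith, by linarith⟩

end BooleanSoS

namespace BooleanSoS

open Polynomial

/-! ### The certificate -/

/-- The univariate polynomial `(t - k) (t - k + 1)`. -/
noncomputable def quadPoly (k : ℕ) : ℝ[X] := (X - C (k : ℝ)) * (X - C (k : ℝ) + 1)

lemma eval_quadPoly (k : ℕ) (t : ℝ) : (quadPoly k).eval t = (t - k) * (t - k + 1) := by
  simp [quadPoly]

lemma eval_quadPoly_natCast_nonneg (k j : ℕ) : 0 ≤ (quadPoly k).eval (j : ℝ) := by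
  rw [eval_quadPoly]
  rcases lt_or_ge j k with h | h
  · have : (j : ℝ) + 1 ≤ k := by exact_mod_cast h
    nlinarith
  · have : (k : ℝ) ≤ j := by exact_mod_cast h
    nlinarith

/-- The summand of the certificate that corrects the value at `j`. -/
noncomputable def bumpPoly (n k M j : ℕ) : ℝ[X] :=
  gapPoly k j * (C ((shiftedChebyshev n k M).eval (j : ℝ))⁻¹ * shiftedChebyshev n k M)

lemma natDegree_bumpPoly_le (n k M j : ℕ) : (bumpPoly n k M j).natDegree ≤ k - j + M :=
  natDegree_mul_le.trans <| add_le_add (natDegree_gapPoly_le k j) <|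
    (natDegree_C_mul_le _ _).trans (natDegree_shiftedChebyshev_le n k M)

/-- A polynomial interpolating `quadPoly k` at `0, …, k` that stays small on `[k + 1, n + 1]`. -/
noncomputable def interpPoly (n k M : ℕ) : ℝ[X] :=
  ∑ j ∈ Finset.range (k - 1),
    C ((quadPoly k).eval (j : ℝ)) * (choosePoly j * bumpPoly n k M j ^ 2)

lemma natDegree_interpPoly_le (n k M : ℕ) : (interpPoly n k M).natDegree ≤ 2 * (k + M) := by
  refine natDegree_sum_le_of_forall_le _ _ fun j hj => ?_
  refine (natDegree_C_mul_le _ _).trans (natDegree_mul_le.trans ?_)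
  have h1 := natDegree_choosePoly_le j
  have h2 := natDegree_pow_le_of_le 2 (natDegree_bumpPoly_le n k M j)
  rw [Finset.mem_range] at hj
  omega

lemma eval_interpPoly (n k M : ℕ) (t : ℝ) : (interpPoly n k M).eval t =
    ∑ j ∈ Finset.range (k - 1), (quadPoly k).eval (j : ℝ) *
      ((choosePoly j).eval t * (bumpPoly n k M j).eval t ^ 2) := by
  simp [interpPoly, eval_finsetSum]

lemma cubeSoS_interpPoly (n k M : ℕ) :
    CubeSoS n (k + M) fun m => (interpPoly n k M).eval (m : ℝ) := by
  simp only [eval_interpPoly]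
  refine CubeSoS.sum _ fun j hj => ?_
  have h := (CubeSoS.const (eval_quadPoly_natCast_nonneg k j) n 0).mul
    ((CubeSoS.choose n j).mul (CubeSoS.sq_eval (bumpPoly n k M j) n))
  simp only [eval_choosePoly_natCast]
  refine h.mono ?_
  have := natDegree_bumpPoly_le n k M j
  rw [Finset.mem_range] at hj
  omega

/-- Only j = i survives. The sum stops before k - 1 because q_k vanishes at k - 1 and k. -/
lemma eval_interpPoly_natCast {n k M i : ℕ} (hi : i ≤ k) :
    (interpPoly n k M).eval (i : ℝ) = (quadPoly k).eval (i : ℝ) := by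
  have hne (j : ℕ) (hij : j ≠ i) : (quadPoly k).eval (j : ℝ) *
      ((choosePoly j).eval (i : ℝ) * (bumpPoly n k M j).eval (i : ℝ) ^ 2) = 0 := by
    rcases lt_or_gt_of_ne hij with h | h
    · simp [bumpPoly, eval_gapPoly_eq_zero h hi]
    · simp [eval_choosePoly_natCast, Nat.choose_eq_zero_of_lt h]
  rw [eval_interpPoly]
  by_cases hik : i < k - 1
  · rw [Finset.sum_eq_single_of_mem i (by simpa using hik) fun j _ hj => hne j hj]
    have hpos := eval_shiftedChebyshev_pos n M (k := k) (t := i) (by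
      have : (i : ℝ) ≤ k := by exact_mod_cast hi
      linarith [Nat.cast_nonneg (α := ℝ) k])
    simp [eval_choosePoly_natCast, bumpPoly, eval_gapPoly_self_sq, hpos.ne']
  · rw [Finset.sum_eq_zero fun j hj => hne j (by rw [Finset.mem_range] at hj; omega),
      eval_quadPoly]
    have : i = k ∨ i + 1 = k := by omega
    rcases this with rfl | rfl <;> simp

lemma eval_interpPoly_le {n k M : ℕ} (hn : 3 ≤ n) (hk2 : 2 ≤ k) (hk : 2 * k ≤ n + 1)
    (hM : 10 * Real.log n * √(2 * (k * n)) ≤ M) {t : ℝ} (ht : k + 1 ≤ t) (htn : t ≤ n + 1) :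
    (interpPoly n k M).eval t ≤ (quadPoly k).eval t := by
  have hn' : (3 : ℝ) ≤ n := by exact_mod_cast hn
  have hk2' : (2 : ℝ) ≤ k := by exact_mod_cast hk2
  have hkn : k ≤ n := by omega
  have hkn' : (k : ℝ) ≤ n := by exact_mod_cast hkn
  have hL : 0 ≤ Real.log n := Real.log_nonneg (by linarith)
  have hterm (j : ℕ) (hj : j ∈ Finset.range (k - 1)) : (quadPoly k).eval (j : ℝ) *
      ((choosePoly j).eval t * (bumpPoly n k M j).eval t ^ 2) ≤ 1 / n := by
    have hj2 : (j : ℝ) + 2 ≤ k := by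
      rw [Finset.mem_range] at hj
      exact_mod_cast (by omega : j + 2 ≤ k)
    have hj0 : (0 : ℝ) ≤ j := Nat.cast_nonneg j
    -- In units of μ log n the exponent of a summand is at most 2 + 2·(2 - 5) = -4: `choosePoly`
    -- once, the gap and Chebyshev factors squared. As μ ≥ 2 this gives n⁻⁸, enough to absorb 4n²
    -- and leave 1/n.
    set μ := min (t - j) (k : ℝ) with hμ
    have hμ2 : 2 ≤ μ := le_min (by linarith) hk2'
    set e := Real.exp (2 * Real.log n * μ) with he
    have hquad : (quadPoly k).eval (j : ℝ) ≤ n ^ 2 := by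
      rw [eval_quadPoly]; nlinarith
    have hchoose : (choosePoly j).eval t ≤ e := by
      rw [eval_choosePoly]
      exact prod_one_add_div_le hn hkn (by simp at hj; omega) (by linarith) (by linarith)
    have hchoose0 : 0 ≤ (choosePoly j).eval t := by
      rw [eval_choosePoly]
      refine Finset.prod_nonneg fun i _ => ?_
      have : 0 ≤ t - j := by linarith
      positivity
    have hgap : |(gapPoly k j).eval t| ≤ e :=
      (abs_eval_gapPoly_le k j (by linarith)).trans
        (prod_one_add_div_le hn hkn (by omega) (by linarith) (by linarith))
    have hjpos := eval_shiftedChebyshev_pos n M (k := k) (t := j) (by linarith)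
    have hcheb : |((shiftedChebyshev n k M).eval (j : ℝ))⁻¹ * (shiftedChebyshev n k M).eval t| ≤
        2 * Real.exp (-(5 * Real.log n * μ)) := by
      rw [abs_mul, abs_inv, abs_of_pos hjpos, inv_mul_le_iff₀ hjpos, mul_comm]
      exact abs_eval_shiftedChebyshev_le (by omega) hk (by linarith) (by positivity)
        (by linarith) hj0 (by linarith) (min_le_left _ _) (min_le_right _ _) (by linarith)
    have hbump : (bumpPoly n k M j).eval t ^ 2 ≤
        (e * (2 * Real.exp (-(5 * Real.log n * μ)))) ^ 2 := by
      rw [← sq_abs]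
      gcongr
      rw [bumpPoly, eval_mul, eval_mul, eval_C, abs_mul]
      gcongr
    have hfin : Real.exp (-(4 * Real.log n * μ)) ≤ 1 / (n : ℝ) ^ 8 := by
      rw [Real.exp_neg, ← one_div]
      have : (n : ℝ) ^ 8 = Real.exp (8 * Real.log n) := by
        rw [show (8 : ℝ) = (8 : ℕ) by norm_num, Real.exp_nat_mul, Real.exp_log (by linarith)]
      rw [this]
      exact one_div_le_one_div_of_le (Real.exp_pos _) (Real.exp_le_exp.2 (by nlinarith))
    calc _ ≤ (n : ℝ) ^ 2 * (e * (e * (2 * Real.exp (-(5 * Real.log n * μ)))) ^ 2) := by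
          gcongr
      _ = 4 * n ^ 2 * Real.exp (-(4 * Real.log n * μ)) := by
        rw [mul_pow, mul_pow, ← Real.exp_nat_mul, he, ← Real.exp_nat_mul]
        rw [show Real.exp (2 * Real.log n * μ) * (Real.exp ((2 : ℕ) * (2 * Real.log n * μ)) *
          (2 ^ 2 * Real.exp ((2 : ℕ) * -(5 * Real.log n * μ)))) = 4 * (Real.exp (2 * Real.log n * μ)
          * Real.exp ((2 : ℕ) * (2 * Real.log n * μ)) *
          Real.exp ((2 : ℕ) * -(5 * Real.log n * μ))) by ring, ← Real.exp_add, ← Real.exp_add]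
        push_cast; ring_nf
      _ ≤ 4 * n ^ 2 * (1 / (n : ℝ) ^ 8) := by gcongr
      _ ≤ 1 / n := by
        have h3 : (4 : ℝ) ≤ n ^ 5 :=
          (by norm_num : (4 : ℝ) ≤ 3 ^ 5).trans (by gcongr)
        rw [mul_one_div, div_le_div_iff₀ (by positivity) (by linarith)]
        have : (0 : ℝ) < n ^ 3 := by positivity
        nlinarith
  rw [eval_interpPoly]
  calc _ ≤ ∑ _j ∈ Finset.range (k - 1), 1 / (n : ℝ) := Finset.sum_le_sum hterm
    _ = ((k - 1 : ℕ) : ℝ) / n := by simp [div_eq_mul_inv]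
    _ ≤ 1 := by
      rw [div_le_one (by linarith)]
      exact_mod_cast (by omega : k - 1 ≤ n)
    -- q_k(t) ≥ 2 for t ≥ k + 1.
    _ ≤ _ := by rw [eval_quadPoly]; nlinarith

/-! ### Assembling the certificate -/

lemma cubeSoS_of_mem_sqClosure {D : ℕ} {s : ℝ[X]} (n : ℕ) (hs : s ∈ sqClosure D) :
    CubeSoS n D fun m => s.eval (m : ℝ) := by
  induction hs using AddSubmonoid.closure_induction with
  | mem x hx =>
    obtain ⟨r, hr, rfl⟩ := hx
    simpa using (CubeSoS.sq_eval r n).mono hr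
  | zero => simpa using CubeSoS.zero n D
  | add x y _ _ hx hy => simpa using hx.add hy

/-- The falling factorial `t (t - 1) ⋯ (t - j + 1)`. -/
noncomputable def fallingPoly (j : ℕ) : ℝ[X] := ∏ i ∈ Finset.range j, (X - C (i : ℝ))

lemma eval_fallingPoly (j : ℕ) (t : ℝ) :
    (fallingPoly j).eval t = ∏ i ∈ Finset.range j, (t - i) := by
  simp [fallingPoly, eval_prod]

lemma eval_fallingPoly_natCast (j m : ℕ) :
    (fallingPoly j).eval (m : ℝ) = j.factorial * m.choose j := by
  rw [← Nat.cast_mul, ← Nat.descFactorial_eq_factorial_mul_choose, eval_fallingPoly]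
  induction j with
  | zero => simp
  | succ j ih =>
    rw [Finset.prod_range_succ, ih, Nat.descFactorial_succ, Nat.cast_mul, mul_comm]
    rcases le_or_gt j m with h | h
    · rw [Nat.cast_sub h]
    · simp [Nat.descFactorial_of_lt h]

lemma cubeSoS_fallingPoly (n j : ℕ) : CubeSoS n j fun m => (fallingPoly j).eval (m : ℝ) := by
  simp only [eval_fallingPoly_natCast]
  exact ((CubeSoS.const (Nat.cast_nonneg j.factorial) n 0).mul (CubeSoS.choose n j)).mono
    (by omega)

/-- The factor t - (k+1) lengthens the falling factorial by one, and n + 1 - t is the number of zero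
coordinates plus one. -/
lemma cubeSoS_fallingPoly_mul {n k D : ℕ} {p : ℝ[X]}
    (hp : IntervalSoS ((k : ℝ) + 1) ((n : ℝ) + 1) D p) :
    CubeSoS n (k + 3 + D) fun m => (fallingPoly (k + 1) * p).eval (m : ℝ) := by
  obtain ⟨s₀, h₀, s₁, h₁, s₂, h₂, s₃, h₃, rfl⟩ := hp
  have hW := cubeSoS_fallingPoly n (k + 1)
  have hW' := cubeSoS_fallingPoly n (k + 2)
  have hV : CubeSoS n 1 fun m => ((n : ℝ) - m) + 1 :=
    (CubeSoS.complement n).add (CubeSoS.const zero_le_one n 1)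
  have k₀ := (hW.mul (cubeSoS_of_mem_sqClosure n h₀)).mono (E := k + 3 + D) (by omega)
  have k₁ := (hW'.mul (cubeSoS_of_mem_sqClosure n h₁)).mono (E := k + 3 + D) (by omega)
  have k₂ := ((hW.mul hV).mul (cubeSoS_of_mem_sqClosure n h₂)).mono (E := k + 3 + D) (by omega)
  have k₃ := ((hW'.mul hV).mul (cubeSoS_of_mem_sqClosure n h₃)).mono (E := k + 3 + D) (by omega)
  refine (((k₀.add k₁).add k₂).add k₃).congr fun m _ => ?_
  have hsucc : (fallingPoly (k + 2)).eval (m : ℝ) =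
      (fallingPoly (k + 1)).eval (m : ℝ) * (m - (k + 1)) := by
    rw [eval_fallingPoly, eval_fallingPoly, Finset.prod_range_succ]
    push_cast; rfl
  simp only [hsucc, eval_mul, eval_add, eval_sub, eval_X, eval_C]
  ring

lemma fallingPoly_dvd {j : ℕ} {p : ℝ[X]} (hp : ∀ i < j, p.eval (i : ℝ) = 0) :
    fallingPoly j ∣ p := by
  refine Finset.prod_dvd_of_coprime (fun a _ b _ hab => ?_) fun i hi =>
    dvd_iff_isRoot.2 (hp i (Finset.mem_range.1 hi))
  exact isCoprime_X_sub_C_of_isUnit_sub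
    (IsUnit.mk0 _ (sub_ne_zero.2 (by exact_mod_cast hab)))

lemma cubeSoS_quadPoly {n k M : ℕ} (hn : 3 ≤ n) (hk2 : 2 ≤ k) (hk : 2 * k ≤ n + 1)
    (hM : 10 * Real.log n * √(2 * (k * n)) ≤ M) :
    CubeSoS n (3 * k + 2 * M + 3) fun m => (quadPoly k).eval (m : ℝ) := by
  obtain ⟨R, hR⟩ := fallingPoly_dvd (j := k + 1) (p := quadPoly k - interpPoly n k M)
    fun i hi => by
      rw [eval_sub, eval_interpPoly_natCast (by omega), sub_self]
  have hW (t : ℝ) (ht : k + 1 ≤ t) : 0 < (fallingPoly (k + 1)).eval t := by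
    rw [eval_fallingPoly]
    refine Finset.prod_pos fun i hi => ?_
    have : (i : ℝ) ≤ k := by
      rw [Finset.mem_range] at hi
      exact_mod_cast (by omega : i ≤ k)
    linarith
  have hRnonneg : ∀ t ∈ Set.Icc ((k : ℝ) + 1) ((n : ℝ) + 1), 0 ≤ R.eval t := fun t ht => by
    have h1 := eval_interpPoly_le hn hk2 hk hM ht.1 ht.2
    have h2 := congrArg (eval t) hR
    rw [eval_sub, eval_mul] at h2
    exact nonneg_of_mul_nonneg_right (h2 ▸ sub_nonneg.2 h1) (hW t ht.1)
  have hRdeg : R.natDegree ≤ 2 * (k + M) := by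
    rcases eq_or_ne R 0 with rfl | h0
    · simp
    have hW0 : fallingPoly (k + 1) ≠ 0 := fun h => by simpa [h] using hW (k + 1) le_rfl
    have h1 : (quadPoly k).natDegree ≤ 2 := by unfold quadPoly; compute_degree
    have h2 := natDegree_sub_le_of_le (h1.trans (by omega : 2 ≤ 2 * (k + M)))
      (natDegree_interpPoly_le n k M)
    rw [hR, natDegree_mul hW0 h0, max_self] at h2
    omega
  -- The right endpoint n + 1 keeps the interval nondegenerate; [k+1, n] is a point when n = 3, k =
  -- 2.
  have hkn : (k : ℝ) + 1 < (n : ℝ) + 1 := by exact_mod_cast (by omega : k + 1 < n + 1)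
  have hI := (intervalSoS_of_nonneg hkn R hRnonneg).mono hRdeg
  refine (((cubeSoS_interpPoly n k M).mono (by omega)).add
    ((cubeSoS_fallingPoly_mul hI).mono (E := 3 * k + 2 * M + 3) (by omega))).congr fun m _ => ?_
  rw [← hR, eval_sub]
  ring

/-! ### Return to n variables and degree asymptotics -/

lemma eval_vertex_sqf {n : ℕ} (k : ℕ) (A : Finset (Fin n)) :
    MvPolynomial.eval (vertex A) (sqf n k) = (quadPoly k).eval (A.card : ℝ) := by
  simp [sqf, eval_quadPoly, CubeSoS.sum_vertex]

lemma totalDegree_sqf_le (n k : ℕ) : (sqf n k).totalDegree ≤ 2 := by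
  have h1 : (∑ i : Fin n, MvPolynomial.X i : MvPolynomial (Fin n) ℝ).totalDegree ≤ 1 :=
    MvPolynomial.totalDegree_finsetSum_le fun i _ => (MvPolynomial.totalDegree_X i).le
  have h2 := (MvPolynomial.totalDegree_sub (∑ i : Fin n, MvPolynomial.X i)
    (MvPolynomial.C (k : ℝ))).trans
    (max_le h1 ((MvPolynomial.totalDegree_C _).le.trans zero_le_one))
  exact (MvPolynomial.totalDegree_mul _ _).trans
    (add_le_add h2 ((MvPolynomial.totalDegree_add _ _).trans (max_le h2 (by simp))))

lemma hasSoSCertificate_sqf {n k M : ℕ} (hn : 3 ≤ n) (hk2 : 2 ≤ k) (hk : 2 * k ≤ n + 1)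
    (hM : 10 * Real.log n * √(2 * (k * n)) ≤ M) :
    HasSoSCertificate (sqf n k) (2 * (3 * k + 2 * M + 3)) := by
  obtain ⟨s, hs, hv⟩ := cubeSoS_quadPoly hn hk2 hk hM
  exact hasSoSCertificate_of_eval_vertex hs ((totalDegree_sqf_le n k).trans (by omega))
    fun A => by rw [eval_vertex_sqf, hv]

theorem exists_hasSoSCertificate_sqf {n k : ℕ} (hk2 : 2 ≤ k) (hk : k ≤ ⌈(n : ℝ) / 2⌉₊) :
    ∃ d : ℕ, (d : ℝ) ≤ 100 * (√((n : ℝ) * (k : ℝ)) * Real.log n) ∧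
      HasSoSCertificate (sqf n k) d := by
  have hk' : 2 * k ≤ n + 1 := by
    by_contra! h
    have h1 : ⌈(n : ℝ) / 2⌉₊ ≤ k - 1 := by
      rw [Nat.ceil_le, Nat.cast_sub (by omega)]
      have : (n : ℝ) + 2 ≤ 2 * k := by exact_mod_cast (by omega : n + 2 ≤ 2 * k)
      push_cast
      linarith
    omega
  have hn : 3 ≤ n := by omega
  have hn' : (3 : ℝ) ≤ n := by exact_mod_cast hn
  have hk2' : (2 : ℝ) ≤ k := by exact_mod_cast hk2
  have hkn : (k : ℝ) ≤ n := by exact_mod_cast (by omega : k ≤ n)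
  have hL : 1 ≤ Real.log n := by
    rw [Real.le_log_iff_exp_le (by linarith)]
    linarith [Real.exp_one_lt_d9]
  refine ⟨_, ?_, hasSoSCertificate_sqf (M := ⌈10 * Real.log n * √(2 * (k * n))⌉₊) hn hk2 hk'
    (Nat.le_ceil _)⟩
  have hM := Nat.ceil_lt_add_one (a := 10 * Real.log n * √(2 * (k * n))) (by positivity)
  set M := ⌈10 * Real.log n * √(2 * (k * n))⌉₊
  set S := √((n : ℝ) * k)
  have hkS : (k : ℝ) ≤ S := Real.le_sqrt_of_sq_le (by nlinarith)
  have hS : √(2 * (k * n)) ≤ 3 / 2 * S := by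
    rw [Real.sqrt_mul zero_le_two, mul_comm (k : ℝ)]
    gcongr
    rw [Real.sqrt_le_left (by norm_num)]
    norm_num
  have h1 : 10 * Real.log n * √(2 * (k * n)) ≤ 15 * (S * Real.log n) := by
    calc _ ≤ 10 * Real.log n * (3 / 2 * S) := by gcongr
      _ = _ := by ring
  have h2 : S ≤ S * Real.log n := le_mul_of_one_le_right (by linarith) hL
  push_cast
  linarith

lemma eventually_mul_sqrt_mul_log_lt {c : ℝ} (hc : 0 < c) (K : ℝ) (k : ℕ) :
    ∀ᶠ n : ℕ in Filter.atTop, K * (√((n : ℝ) * (k : ℝ)) * Real.log n) < c * n := by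
  -- log n = o(√n); the + 1 keeps the denominator positive and the 2 makes the final inequality
  -- strict.
  have h := (isLittleO_log_rpow_atTop (r := 1 / 2) (by norm_num)).bound
    (c := c / (2 * (|K| * √k + 1))) (by positivity)
  filter_upwards [tendsto_natCast_atTop_atTop.eventually h, Filter.eventually_ge_atTop 1]
    with n hn hn1
  have hn1' : (1 : ℝ) ≤ n := by exact_mod_cast hn1
  have hL : 0 ≤ Real.log n := Real.log_nonneg hn1'
  rw [← Real.sqrt_eq_rpow, Real.norm_of_nonneg hL, Real.norm_of_nonneg (Real.sqrt_nonneg _),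
    div_mul_eq_mul_div, le_div_iff₀ (by positivity)] at hn
  have hsq : √(n : ℝ) * √n = n := Real.mul_self_sqrt (by linarith)
  have hs : 0 < √(n : ℝ) := Real.sqrt_pos.2 (by linarith)
  rw [Real.sqrt_mul (by linarith)]
  calc K * (√(n : ℝ) * √k * Real.log n) ≤ |K| * (√(n : ℝ) * √k * Real.log n) := by
        gcongr; exact le_abs_self K
    _ = √n * (Real.log n * (|K| * √k)) := by ring
    _ ≤ √n * (Real.log n * (|K| * √k + 1)) := by gcongr; linarith
    _ ≤ √n * (c * √n / 2) := by gcongr; linarith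
    _ = c * (√n * √n) / 2 := by ring
    _ = c * n / 2 := by rw [hsq]
    _ < c * n := half_lt_self (by positivity)

end BooleanSoS

theorem theorem1 :
    (∃ K : ℝ, 0 < K ∧ ∀ n k : ℕ, 2 ≤ k → k ≤ ⌈(n : ℝ) / 2⌉₊ →
      ∃ d : ℕ, (d : ℝ) ≤ K * (Real.sqrt ((n : ℝ) * (k : ℝ)) * Real.log (n : ℝ)) ∧
        BooleanSoS.HasSoSCertificate (BooleanSoS.sqf n k) d) ∧
    (∀ k : ℕ, 2 ≤ k →
      ¬ ∃ c : ℝ, 0 < c ∧ ∀ᶠ n : ℕ in Filter.atTop, ∀ d : ℕ,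
        BooleanSoS.HasSoSCertificate (BooleanSoS.sqf n k) d → c * (n : ℝ) ≤ (d : ℝ)) := by
  refine ⟨⟨100, by norm_num, fun n k hk2 hk =>
    BooleanSoS.exists_hasSoSCertificate_sqf hk2 hk⟩, ?_⟩
  rintro k hk2 ⟨c, hc, hev⟩
  obtain ⟨n, h1, h2, h3⟩ := (hev.and ((BooleanSoS.eventually_mul_sqrt_mul_log_lt hc 100 k).and
    (Filter.eventually_ge_atTop (2 * k)))).exists
  obtain ⟨d, hd, hcert⟩ := BooleanSoS.exists_hasSoSCertificate_sqf (n := n) hk2 (by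
    have h4 : (2 * k : ℝ) ≤ n := by exact_mod_cast h3
    have h5 : (k : ℝ) ≤ n / 2 := by linarith
    exact_mod_cast h5.trans (Nat.le_ceil _))
  exact absurd (h1 d hcert) (not_le.2 (hd.trans_lt h2))
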